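/- Work on the Hilbert space $L^2(\mathbb R;\mathbb C)$ of a single bosonic mode ($\hbar=1$), with position operator $X$, momentum operator $P=-i\,d/dx$ and Fock states $|n\rangle$, $n=0,1,2,\dots$, given by the wave functions $$\psi_n(x)=\frac{H_n(x)}{\sqrt{2^n\,n!\,\sqrt\pi}}\,e^{-x^2/2},$$ where $H_n$ are the (physicists') Hermite polynomials. A state is a positive operator $\hat\rho$ of trace one; it is called Gaussian if its characteristic function is Gaussian, that is, if there are $m\in\mathbb R^2$ and a real symmetric positive definite $2\times2$ matrix $V$ such that for all $\xi=(s,t)\in\mathbb R^2$ $$\operatorname{Tr}\!\left(\hat\rho\,e^{i(sX+tP)}\right)=\exp\!\left(i\,m\cdot\xi-\tfrac12\,\xi\cdot V\xi\right).$$ Let $d\ge 2$ be a (finite) integer and let $\hat\rho$ be a state whose range is contained in the span of the first $d$ Fock states $|0\rangle,\dots,|d-1\rangle$. Then $\hat\rho$ is Gaussian if and only if $\hat\rho=|0\rangle\langle 0|$. In particular, every genuinely $d$-dimensional state is non-Gaussian: if the range of $\hat\rho$ is not contained in the span of the first $d-1$ Fock states, or if $\hat\rho$ has rank $d$, then $\hat\rho$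 is not Gaussian. -/

import Mathlib

open MeasureTheory

noncomputable section

namespace SingleMode

/-- The Hilbert space `L²(ℝ; ℂ)` of a single bosonic mode in the position representation (`ħ = 1`). -/
abbrev ModeSpace : Type := Lp ℂ 2 (volume : Measure ℝ)

/-! ### Fock states -/

/-- The physicists' Hermite polynomials: `H₀ = 1`, `H₁ = 2X`, `H₂ = 4X² - 2`, and so on. -/
def physHermite : ℕ → Polynomial ℝ
  | 0 => 1
  | n + 1 => 2 * Polynomial.X * physHermite n - Polynomial.derivative (physHermite n)

/-- The Hermite function
`ψₙ(x) = Hₙ(x) exp(-x²/2) / √(2ⁿ n! √π)`, the position wave function of the `n`-th Fock state. -/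
def hermiteFun (n : ℕ) (x : ℝ) : ℝ :=
  (physHermite n).eval x / Real.sqrt (2 ^ n * (n.factorial : ℝ) * Real.sqrt Real.pi)
    * Real.exp (-(x ^ 2) / 2)

theorem integrable_poly_mul_gaussian (p : Polynomial ℝ) :
    Integrable (fun x : ℝ => p.eval x * Real.exp (-(x ^ 2))) := by
  induction p using Polynomial.induction_on' with
  | add p q hp hq => exact (hp.add hq).congr (Filter.Eventually.of_forall fun x => by simp [add_mul])
  | monomial n a =>
    have h := (integrable_rpow_mul_exp_neg_mul_sq (b := 1) one_pos (s := n)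
      (by have : (0 : ℝ) ≤ n := n.cast_nonneg
          linarith)).const_mul a
    simpa [mul_assoc] using h

theorem memLp_hermiteFun (n : ℕ) :
    MemLp (fun x : ℝ => (hermiteFun n x : ℂ)) 2 (volume : Measure ℝ) := by
  have hc : Continuous (hermiteFun n) := by
    unfold hermiteFun
    fun_prop
  refine MemLp.ofReal ((memLp_two_iff_integrable_sq hc.aestronglyMeasurable).2 ?_)
  have h := (integrable_poly_mul_gaussian (physHermite n ^ 2)).const_mul
    ((Real.sqrt (2 ^ n * (n.factorial : ℝ) * Real.sqrt Real.pi))⁻¹ ^ 2)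
  refine h.congr (Filter.Eventually.of_forall fun x => ?_)
  have he : Real.exp (-(x ^ 2)) = Real.exp (-(x ^ 2) / 2) ^ 2 := by
    rw [← Real.exp_nat_mul]
    congr 1
    push_cast
    ring
  simp only [hermiteFun, Polynomial.eval_pow, he]
  ring

/-- The Fock state `|n⟩`, as a vector of `L²(ℝ; ℂ)`. -/
def fock (n : ℕ) : ModeSpace := (memLp_hermiteFun n).toLp _

/-- The span of the first `d` Fock states `|0⟩, …, |d-1⟩`. -/
def fockSpan (d : ℕ) : Submodule ℂ ModeSpace := Submodule.span ℂ (fock '' {n | n < d})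

/-- The vacuum state `|0⟩⟨0|`. -/
def vacuum : ModeSpace →L[ℂ] ModeSpace := InnerProductSpace.rankOne ℂ (fock 0) (fock 0)

/-! ### Density operators -/

/-- `T` has a well-defined trace (equivalently, `T` is trace class), and the trace is `t`. -/
def HasTrace (T : ModeSpace →L[ℂ] ModeSpace) (t : ℂ) : Prop :=
  ∀ (ι : Type) (b : HilbertBasis ι ℂ ModeSpace), HasSum (fun i => inner ℂ (b i) (T (b i))) t

/-- Quantum states: positive operators of trace one. -/
structure IsDensityOperator (ρ : ModeSpace →L[ℂ] ModeSpace) : Prop where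
  isPositive : ρ.IsPositive
  hasTrace_one : HasTrace ρ 1

/-! ### Weyl operators and Gaussian states -/

theorem measurePreserving_shift (t : ℝ) :
    MeasurePreserving (fun x : ℝ => x + t) volume volume :=
  measurePreserving_add_right volume t

/-- The phase `exp(i (s x + s t / 2))`. -/
def weylPhase (s t x : ℝ) : ℂ := Complex.exp (((s * x + s * t / 2 : ℝ) : ℂ) * Complex.I)

theorem norm_weylPhase (s t x : ℝ) : ‖weylPhase s t x‖ = 1 :=
  Complex.norm_exp_ofReal_mul_I _

theorem continuous_weylPhase (s t : ℝ) : Continuous (weylPhase s t) := by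
  unfold weylPhase
  fun_prop

theorem memLp_weyl (s t : ℝ) (f : ModeSpace) :
    MemLp (fun x : ℝ => weylPhase s t x * f (x + t)) 2 (volume : Measure ℝ) := by
  have h := (Lp.memLp f).comp_measurePreserving (measurePreserving_shift t)
  refine h.of_le ((continuous_weylPhase s t).aestronglyMeasurable.mul h.1)
    (Filter.Eventually.of_forall fun x => ?_)
  simp [norm_weylPhase]

/-- The Weyl (displacement) operator `exp(i (s X + t P))` with `X` the position operator and
`P = -i d/dx` the momentum operator: `(W(s,t) f)(x) = exp(i (s x + s t / 2)) f(x + t)`. -/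
def weyl (s t : ℝ) : ModeSpace →L[ℂ] ModeSpace :=
  LinearMap.mkContinuous
    { toFun := fun f => (memLp_weyl s t f).toLp _
      map_add' := fun f g => by
        rw [← MemLp.toLp_add]
        refine MemLp.toLp_congr _ _ ?_
        filter_upwards [(measurePreserving_shift t).quasiMeasurePreserving.ae
          (Lp.coeFn_add f g)] with x hx
        simp only [Pi.add_apply] at hx ⊢
        rw [hx, mul_add]
      map_smul' := fun c f => by
        rw [RingHom.id_apply, ← MemLp.toLp_const_smul]
        refine MemLp.toLp_congr _ _ ?_
        filter_upwards [(measurePreserving_shift t).quasiMeasurePreserving.ae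
          (Lp.coeFn_smul c f)] with x hx
        simp only [Pi.smul_apply, smul_eq_mul] at hx ⊢
        rw [hx]
        ring }
    1
    (fun f => by
      have h : eLpNorm (fun x : ℝ => weylPhase s t x * f (x + t)) 2 volume
          = eLpNorm f 2 volume := by
        rw [← eLpNorm_comp_measurePreserving (Lp.aestronglyMeasurable f)
          (measurePreserving_shift t)]
        refine eLpNorm_congr_norm_ae (Filter.Eventually.of_forall fun x => ?_)
        simp [norm_weylPhase]
      change ‖(memLp_weyl s t f).toLp _‖ ≤ 1 * ‖f‖
      rw [Lp.norm_toLp, h, one_mul, Lp.norm_def])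

/-- `ρ` is a Gaussian state: its characteristic function `(s, t) ↦ Tr(ρ exp(i (s X + t P)))` is
the Gaussian `exp(i m·ξ - ξ·Vξ / 2)`, `ξ = (s, t)`, with some mean vector `m` of `(X, P)` and some
(real symmetric positive definite) covariance matrix `V`. -/
def IsGaussianState (ρ : ModeSpace →L[ℂ] ModeSpace) : Prop :=
  IsDensityOperator ρ ∧
  ∃ (m : Fin 2 → ℝ) (V : Matrix (Fin 2) (Fin 2) ℝ), V.PosDef ∧
    ∀ s t : ℝ, HasTrace (ρ ∘L weyl s t)
      (Complex.exp (Complex.I * ((m ⬝ᵥ ![s, t] : ℝ) : ℂ)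
        - ((![s, t] ⬝ᵥ V.mulVec ![s, t] : ℝ) : ℂ) / 2))

end SingleMode

end

noncomputable section

namespace SingleMode

open InnerProductSpace

/-! The position distribution alone decides the matter. A state supported on finitely many Fock
states is a finite sum of `rankOne ℂ (u i) (u i)` with `u i = (a i + b i * I) * exp (-x²/2)`, so its
position density is `Q * exp (-x²)` with `Q = ∑ (a i² + b i²)`. Gaussianity at `t = 0` makes this a
normal density, so the polynomial `Q` is the exponential of a quadratic up to a factor, hence
constant (`exists_eq_C_of_charFun_eq`). Then all `a i`, `b i` are bounded, hence constant: every `u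
i` is a multiple of `fock 0`, and trace one leaves only the vacuum. The converse is a Gaussian
integral. -/

/-- With `P` the projection onto `F`, `P T = T` and symmetry give `T P = T`, so `T` is determined by
its compression to the finite-dimensional `F`. -/
theorem exists_eq_sum_rankOne_of_range_le {H : Type*} [NormedAddCommGroup H]
    [InnerProductSpace ℂ H] [CompleteSpace H] {T : H →L[ℂ] H} (hT : T.IsPositive)
    {F : Submodule ℂ H} [FiniteDimensional ℂ F] (hF : LinearMap.range T.toLinearMap ≤ F) :
    ∃ (m : ℕ) (u : Fin m → H), (∀ i, u i ∈ F) ∧ T = ∑ i, rankOne ℂ (u i) (u i) := by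
  obtain ⟨m, u, hu⟩ := ContinuousLinearMap.isPositive_iff_eq_sum_rankOne.1
    (hT.orthogonalProjectionOnto_comp F)
  refine ⟨m, fun i => u i, fun i => (u i).2, ?_⟩
  have hTP : ∀ x, T (F.starProjection x) = T x := by
    intro x
    refine ext_inner_left ℂ fun y => ?_
    have h := Submodule.inner_starProjection_left_eq_right F (T y) x
    rw [show F.starProjection (T y) = T y from
      F.starProjection_eq_self_iff.2 (hF ⟨y, rfl⟩)] at h
    rw [← hT.isSymmetric.apply_clm, ← h, hT.isSymmetric.apply_clm]
  ext x
  have h := congrArg (fun S => ((S (F.orthogonalProjectionOnto x) : F) : H)) hu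
  have h1 : ((F.orthogonalProjectionOnto (T (F.starProjection x)) : F) : H) = T x := by
    rw [hTP]
    exact F.starProjection_eq_self_iff.2 (hF ⟨x, rfl⟩)
  simp only [ContinuousLinearMap.comp_apply, Submodule.subtypeL_apply] at h
  refine h1.symm.trans (h.trans ?_)
  simp

/-- Differentiation gives `Q' = q' Q`; a nonzero `Q'` would have degree at least that of `Q`. -/
theorem eq_C_of_eval_eq_mul_exp {Q q : Polynomial ℝ} {c : ℝ} (hc : c ≠ 0)
    (h : ∀ x, Q.eval x = c * Real.exp (q.eval x)) : ∃ r, Q = Polynomial.C r := by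
  have hQ0 : Q ≠ 0 := by
    rintro rfl
    have := h 0
    simp [hc] at this
  have hd : Polynomial.derivative Q = Polynomial.derivative q * Q := by
    refine Polynomial.funext fun x => ?_
    have h1 := Q.hasDerivAt x
    have h2 := ((q.hasDerivAt x).exp).const_mul c
    have h3 : (fun x => Q.eval x) = fun x => c * Real.exp (q.eval x) := funext h
    rw [h3] at h1
    rw [h1.unique h2, Polynomial.eval_mul, h]
    ring
  refine ⟨Q.coeff 0, Polynomial.eq_C_of_derivative_eq_zero ?_⟩
  by_contra hne
  have hlt := Polynomial.degree_derivative_lt hQ0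
  rw [hd] at hlt hne
  have := Polynomial.degree_le_mul_left Q (left_ne_zero_of_mul hne)
  rw [mul_comm] at this
  exact absurd hlt this.not_gt

theorem eq_C_of_sq_le {a : Polynomial ℝ} {r : ℝ} (h : ∀ x, a.eval x ^ 2 ≤ r) :
    a = Polynomial.C (a.coeff 0) := by
  refine Polynomial.eq_C_of_degree_le_zero
    ((Polynomial.isBoundedUnder_abs_atTop_iff a).1 ⟨√r, ?_⟩)
  simp only [Filter.eventually_map]
  exact Filter.Eventually.of_forall fun x => Real.abs_le_sqrt (h x)

/-! ### Traces of finite-rank operators -/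

theorem HasTrace.unique {T : ModeSpace →L[ℂ] ModeSpace} {t u : ℂ} (ht : HasTrace T t)
    (hu : HasTrace T u) : t = u := by
  obtain ⟨w, b, -⟩ := exists_hilbertBasis ℂ ModeSpace
  exact (ht _ b).unique (hu _ b)

/-- Parseval's identity for `W† v` and `u`, in any Hilbert basis. -/
theorem hasTrace_rankOne_comp (u v : ModeSpace) (W : ModeSpace →L[ℂ] ModeSpace) :
    HasTrace (rankOne ℂ u v ∘L W) (inner ℂ v (W u)) := by
  intro ι b
  have h := b.hasSum_inner_mul_inner (ContinuousLinearMap.adjoint W v) u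
  rw [ContinuousLinearMap.adjoint_inner_left] at h
  refine h.congr_fun fun i => ?_
  simp [ContinuousLinearMap.adjoint_inner_left, inner_smul_right]

theorem HasTrace.sum {κ : Type*} (s : Finset κ) {T : κ → ModeSpace →L[ℂ] ModeSpace} {t : κ → ℂ}
    (h : ∀ k ∈ s, HasTrace (T k) (t k)) : HasTrace (∑ k ∈ s, T k) (∑ k ∈ s, t k) := by
  intro ι b
  refine (hasSum_sum fun k hk => h k hk ι b).congr_fun fun i => ?_
  simp [inner_sum]

theorem hasTrace_sum_rankOne_comp {κ : Type*} [Fintype κ] (u : κ → ModeSpace)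
    (W : ModeSpace →L[ℂ] ModeSpace) :
    HasTrace ((∑ k, rankOne ℂ (u k) (u k)) ∘L W) (∑ k, inner ℂ (u k) (W (u k))) := by
  rw [ContinuousLinearMap.finsetSum_comp]
  exact HasTrace.sum _ fun k _ => hasTrace_rankOne_comp _ _ _

/-! ### Wave functions and the vacuum -/

theorem exists_polynomial_of_mem_fockSpan {d : ℕ} {v : ModeSpace} (hv : v ∈ fockSpan d) :
    ∃ a b : Polynomial ℝ, v =ᵐ[volume] fun x : ℝ =>
      (((a.eval x : ℝ) : ℂ) + ((b.eval x : ℝ) : ℂ) * Complex.I) * (Real.exp (-(x ^ 2) / 2) : ℂ) := by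
  induction hv using Submodule.span_induction with
  | mem v hv =>
    obtain ⟨n, -, rfl⟩ := hv
    refine ⟨Polynomial.C (√(2 ^ n * (n.factorial : ℝ) * √Real.pi))⁻¹ * physHermite n, 0, ?_⟩
    filter_upwards [(memLp_hermiteFun n).coeFn_toLp] with x hx
    rw [fock, hx]
    simp [hermiteFun]
    ring
  | zero =>
    refine ⟨0, 0, ?_⟩
    filter_upwards [Lp.coeFn_zero ℂ 2 (volume : Measure ℝ)] with x hx
    rw [hx]
    simp
  | add v w _ _ hv hw =>
    obtain ⟨a, b, hv⟩ := hv
    obtain ⟨a', b', hw⟩ := hw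
    refine ⟨a + a', b + b', ?_⟩
    filter_upwards [Lp.coeFn_add v w, hv, hw] with x hx hv hw
    rw [hx, Pi.add_apply, hv, hw]
    simp
    ring
  | smul c v _ hv =>
    obtain ⟨a, b, hv⟩ := hv
    refine ⟨Polynomial.C c.re * a - Polynomial.C c.im * b,
      Polynomial.C c.re * b + Polynomial.C c.im * a, ?_⟩
    filter_upwards [Lp.coeFn_smul c v, hv] with x hx hv
    rw [hx, Pi.smul_apply, hv, smul_eq_mul]
    have hc := Complex.re_add_im c
    simp
    linear_combination ((c.im : ℂ) * ((b.eval x : ℝ) : ℂ) * Complex.exp (-(x : ℂ) ^ 2 / 2)) *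
      Complex.I_sq - (((a.eval x : ℝ) : ℂ) + ((b.eval x : ℝ) : ℂ) * Complex.I) *
        Complex.exp (-(x : ℂ) ^ 2 / 2) * hc

theorem coeFn_weyl (s t : ℝ) (f : ModeSpace) :
    weyl s t f =ᵐ[volume] fun x : ℝ => weylPhase s t x * f (x + t) :=
  (memLp_weyl s t f).coeFn_toLp

/-- At `t = 0` the Weyl operator is multiplication by `exp (i s x)`, so only `|v|²` enters. -/
theorem inner_weyl_zero_right {v : ModeSpace} {a b : Polynomial ℝ}
    (hv : v =ᵐ[volume] fun x : ℝ =>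
      (((a.eval x : ℝ) : ℂ) + ((b.eval x : ℝ) : ℂ) * Complex.I) * (Real.exp (-(x ^ 2) / 2) : ℂ)) (s : ℝ) :
    inner ℂ v (weyl s 0 v) =
      ∫ x : ℝ, (((a ^ 2 + b ^ 2).eval x * Real.exp (-(x ^ 2)) : ℝ) : ℂ) *
        Complex.exp (s * x * Complex.I) := by
  rw [L2.inner_def]
  refine integral_congr_ae ?_
  filter_upwards [hv, coeFn_weyl s 0 v] with x hx hw
  have he : Real.exp (-(x ^ 2)) = Real.exp (-(x ^ 2) / 2) ^ 2 := by
    rw [← Real.exp_nat_mul]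
    congr 1
    push_cast
    ring
  rw [hw, add_zero, hx, he, weylPhase]
  simp only [RCLike.inner_apply, map_mul, map_add, Complex.conj_ofReal, Complex.conj_I]
  simp
  ring_nf
  simp
  ring

theorem fock_zero_coeFn : fock 0 =ᵐ[volume] fun x : ℝ =>
    (((√(√Real.pi))⁻¹ * Real.exp (-(x ^ 2) / 2) : ℝ) : ℂ) := by
  filter_upwards [(memLp_hermiteFun 0).coeFn_toLp] with x hx
  rw [fock, hx]
  simp [hermiteFun, physHermite]

theorem eq_smul_fock_zero {v : ModeSpace} {α : ℂ}
    (hv : v =ᵐ[volume] fun x : ℝ => α * (Real.exp (-(x ^ 2) / 2) : ℂ)) :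
    v = (α * (√(√Real.pi) : ℂ)) • fock 0 := by
  refine Lp.ext ?_
  filter_upwards [hv, Lp.coeFn_smul (α * (√(√Real.pi) : ℂ)) (fock 0), fock_zero_coeFn]
    with x h1 h2 h3
  have h0 : (√(√Real.pi) : ℂ) ≠ 0 := by
    exact_mod_cast (Real.sqrt_pos.2 (Real.sqrt_pos.2 Real.pi_pos)).ne'
  rw [h1, h2, Pi.smul_apply, h3, smul_eq_mul]
  push_cast
  field_simp

theorem inner_fock_zero_weyl (s t : ℝ) :
    inner ℂ (fock 0) (weyl s t (fock 0)) = Complex.exp (-((s : ℂ) ^ 2 + (t : ℂ) ^ 2) / 4) := by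
  have hint : inner ℂ (fock 0) (weyl s t (fock 0)) = ∫ x : ℝ, ((√Real.pi : ℂ))⁻¹ *
      Complex.exp (-1 * (x : ℂ) ^ 2 + (Complex.I * s - t) * x
        + (Complex.I * s * t / 2 - t ^ 2 / 2)) := by
    rw [L2.inner_def]
    refine integral_congr_ae ?_
    filter_upwards [fock_zero_coeFn, coeFn_weyl s t (fock 0),
      (measurePreserving_shift t).quasiMeasurePreserving.ae fock_zero_coeFn] with x h1 h2 h3
    rw [h2, h1, h3, weylPhase, RCLike.inner_apply, Complex.conj_ofReal]
    have hs : (√Real.pi : ℂ) = (√(√Real.pi) : ℂ) ^ 2 := by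
      rw [← Complex.ofReal_pow, Real.sq_sqrt (Real.sqrt_nonneg _)]
    rw [hs]
    push_cast
    have : Complex.exp (-1 * (x : ℂ) ^ 2 + (Complex.I * s - t) * x
        + (Complex.I * s * t / 2 - t ^ 2 / 2)) =
        Complex.exp ((s * x + s * t / 2) * Complex.I) * Complex.exp (-((x : ℂ) + t) ^ 2 / 2) *
          Complex.exp (-(x : ℂ) ^ 2 / 2) := by
      rw [← Complex.exp_add, ← Complex.exp_add]
      congr 1
      ring
    rw [this]
    ring
  rw [hint, integral_const_mul, integral_cexp_quadratic (by simp)]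
  have hp : ((Real.pi : ℂ) / -(-1)) ^ (1 / 2 : ℂ) = (√Real.pi : ℂ) := by
    rw [Real.sqrt_eq_rpow, Complex.ofReal_cpow Real.pi_pos.le]
    simp
  have h0 : (√Real.pi : ℂ) ≠ 0 := by exact_mod_cast (Real.sqrt_pos.2 Real.pi_pos).ne'
  rw [hp, inv_mul_cancel_left₀ h0]
  congr 1
  linear_combination ((s : ℂ) ^ 2 / 4) * Complex.I_sq

theorem hasTrace_vacuum_weyl (s t : ℝ) :
    HasTrace (vacuum ∘L weyl s t) (Complex.exp (-((s : ℂ) ^ 2 + (t : ℂ) ^ 2) / 4)) := by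
  rw [← inner_fock_zero_weyl]
  exact hasTrace_rankOne_comp _ _ _

theorem weyl_zero_zero : weyl 0 0 = ContinuousLinearMap.id ℂ ModeSpace := by
  ext1 f
  refine Lp.ext ?_
  filter_upwards [coeFn_weyl 0 0 f] with x hx
  simp [hx, weylPhase]

theorem hasTrace_vacuum : HasTrace vacuum 1 := by
  simpa [weyl_zero_zero] using hasTrace_vacuum_weyl 0 0

theorem isGaussianState_vacuum : IsGaussianState vacuum := by
  -- Covariance `1/2` turns `-ξ·Vξ/2` into `-(s² + t²)/4`.
  refine ⟨⟨isPositive_rankOne_self _, hasTrace_vacuum⟩, 0, (2⁻¹ : ℝ) • 1,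
    Matrix.PosDef.one.smul (by norm_num), fun s t => ?_⟩
  convert hasTrace_vacuum_weyl s t using 2
  simp [Matrix.smul_mulVec, dotProduct, Fin.sum_univ_two]
  ring

/-! ### Rigidity of the position density -/

/-- Characteristic functions determine finite measures, so the densities agree almost everywhere
and, being continuous, everywhere. -/
theorem exists_eq_C_of_charFun_eq {Q : Polynomial ℝ} (hQ : ∀ x, 0 ≤ Q.eval x) {m v : ℝ}
    (hv : 0 < v)
    (h : ∀ s : ℝ, ∫ x : ℝ, ((Q.eval x * Real.exp (-(x ^ 2)) : ℝ) : ℂ) *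
        Complex.exp (s * x * Complex.I) =
      Complex.exp (s * m * Complex.I - v * s ^ 2 / 2)) :
    ∃ r, Q = Polynomial.C r := by
  lift v to NNReal using hv.le
  have hv0 : v ≠ 0 := by rintro rfl; simp at hv
  have hnn : ∀ x, 0 ≤ Q.eval x * Real.exp (-(x ^ 2)) := fun x =>
    mul_nonneg (hQ x) (Real.exp_pos _).le
  have hcont : Continuous fun x => Q.eval x * Real.exp (-(x ^ 2)) := by fun_prop
  have hfin : ∫⁻ x, ENNReal.ofReal (Q.eval x * Real.exp (-(x ^ 2))) ≠ ⊤ :=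
    (integrable_poly_mul_gaussian Q).lintegral_lt_top.ne
  set μ : Measure ℝ := volume.withDensity fun x => ENNReal.ofReal (Q.eval x * Real.exp (-(x ^ 2)))
    with hμ
  have : IsFiniteMeasure μ := isFiniteMeasure_withDensity hfin
  have heq : μ = ProbabilityTheory.gaussianReal m v := by
    refine Measure.ext_of_charFun (funext fun s => ?_)
    rw [ProbabilityTheory.charFun_gaussianReal, charFun_apply_real, hμ,
      integral_withDensity_eq_integral_toReal_smul₀ (by fun_prop) (by simp), ← h s]
    refine integral_congr_ae (Filter.Eventually.of_forall fun x => ?_)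
    simp only [ENNReal.toReal_ofReal (hnn x), Complex.real_smul]
  rw [ProbabilityTheory.gaussianReal_of_var_ne_zero _ hv0, hμ,
    withDensity_eq_iff (by fun_prop) (by fun_prop) hfin] at heq
  have hae : (fun x => Q.eval x * Real.exp (-(x ^ 2))) =ᵐ[volume]
      ProbabilityTheory.gaussianPDFReal m v := by
    filter_upwards [heq] with x hx
    rw [ProbabilityTheory.gaussianPDF, ENNReal.ofReal_eq_ofReal_iff (hnn x)
      (ProbabilityTheory.gaussianPDFReal_nonneg _ _ _)] at hx
    exact hx
  have hall := (Continuous.ae_eq_iff_eq volume hcont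
    (by unfold ProbabilityTheory.gaussianPDFReal; fun_prop)).1 hae
  -- The normal density multiplied by `exp (x²)`.
  refine eq_C_of_eval_eq_mul_exp (c := (√(2 * Real.pi * v))⁻¹)
    (q := Polynomial.X ^ 2 - Polynomial.C (2 * (v : ℝ))⁻¹ * (Polynomial.X - Polynomial.C m) ^ 2)
    (by positivity) fun x => ?_
  have hx := congrFun hall x
  simp only [ProbabilityTheory.gaussianPDFReal] at hx
  have hx2 : Q.eval x = Q.eval x * Real.exp (-(x ^ 2)) * Real.exp (x ^ 2) := by
    rw [mul_assoc, ← Real.exp_add]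
    simp
  rw [hx2, hx, mul_assoc, ← Real.exp_add]
  congr 2
  simp
  ring

instance (d : ℕ) : FiniteDimensional ℂ (fockSpan d) :=
  FiniteDimensional.span_of_finite ℂ ((Set.finite_lt_nat d).image _)

theorem IsGaussianState.eq_vacuum {d : ℕ} {ρ : ModeSpace →L[ℂ] ModeSpace}
    (hρ : IsGaussianState ρ) (hsupp : LinearMap.range ρ.toLinearMap ≤ fockSpan d) :
    ρ = vacuum := by
  obtain ⟨hd, m, V, hV, htr⟩ := hρ
  obtain ⟨n, u, hu, rfl⟩ := exists_eq_sum_rankOne_of_range_le hd.isPositive hsupp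
  choose a b hab using fun i => exists_polynomial_of_mem_fockSpan (hu i)
  have hnn : ∀ i x, 0 ≤ (a i ^ 2 + b i ^ 2).eval x := fun i x => by
    simp only [Polynomial.eval_add, Polynomial.eval_pow]
    positivity
  have hQ : ∀ x, (∑ i, (a i ^ 2 + b i ^ 2)).eval x = ∑ i, (a i ^ 2 + b i ^ 2).eval x := fun x =>
    Polynomial.eval_finsetSum _ _ _
  -- `m 0` and `V 0 0` are the mean and variance of position.
  obtain ⟨r, hr⟩ := exists_eq_C_of_charFun_eq (Q := ∑ i, (a i ^ 2 + b i ^ 2)) (m := m 0)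
    (v := V 0 0) (fun x => by rw [hQ]; exact Finset.sum_nonneg fun i _ => hnn i x)
    (hV.diag_pos) fun s => by
      have h1 := (hasTrace_sum_rankOne_comp u (weyl s 0)).unique (htr s 0)
      have h2 : ∀ i, Integrable fun x : ℝ =>
          (((a i ^ 2 + b i ^ 2).eval x * Real.exp (-(x ^ 2)) : ℝ) : ℂ) *
            Complex.exp (s * x * Complex.I) := fun i => by
        refine (integrable_poly_mul_gaussian (a i ^ 2 + b i ^ 2)).ofReal.mul_bdd (c := 1)
          (by fun_prop) (Filter.Eventually.of_forall fun x => ?_)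
        rw [← Complex.ofReal_mul, Complex.norm_exp_ofReal_mul_I]
      simp_rw [inner_weyl_zero_right (hab _), ← integral_finsetSum _ fun i _ => h2 i] at h1
      simp_rw [hQ, Finset.sum_mul, Complex.ofReal_sum, Finset.sum_mul]
      rw [h1]
      congr 1
      simp [dotProduct, Matrix.mulVec, Fin.sum_univ_two]
      ring
  have hle : ∀ i x, (a i).eval x ^ 2 + (b i).eval x ^ 2 ≤ r := fun i x => by
    have h1 := hQ x
    rw [hr, Polynomial.eval_C] at h1
    rw [h1]
    have h2 := Finset.single_le_sum (fun j _ => hnn j x) (Finset.mem_univ i)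
    simpa using h2
  have hvac : ∀ i, ∃ c : ℂ, u i = c • fock 0 := fun i => by
    have ha := eq_C_of_sq_le fun x => (le_add_of_nonneg_right (sq_nonneg _)).trans (hle i x)
    have hb := eq_C_of_sq_le fun x => (le_add_of_nonneg_left (sq_nonneg _)).trans (hle i x)
    have h := hab i
    rw [ha, hb] at h
    simp only [Polynomial.eval_C] at h
    exact ⟨_, eq_smul_fock_zero h⟩
  choose c hc using hvac
  have hsmul : ∑ i, rankOne ℂ (u i) (u i) = (∑ i, c i * (starRingEnd ℂ) (c i)) • vacuum := by
    rw [Finset.sum_smul]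
    refine Finset.sum_congr rfl fun i _ => ?_
    rw [hc i]
    simp [vacuum, smul_smul]
  have htrace : HasTrace ((∑ i, c i * (starRingEnd ℂ) (c i)) • vacuum)
      (∑ i, c i * (starRingEnd ℂ) (c i)) := by
    intro ι β
    have := (hasTrace_vacuum ι β).mul_left (∑ i, c i * (starRingEnd ℂ) (c i))
    rw [mul_one] at this
    refine this.congr_fun fun i => ?_
    simp only [smul_apply, inner_smul_right]
  rw [← hsmul] at htrace
  rw [hsmul, htrace.unique hd.hasTrace_one, one_smul]

theorem range_vacuum_le : LinearMap.range vacuum.toLinearMap ≤ Submodule.span ℂ {fock 0} := by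
  rintro _ ⟨x, rfl⟩
  exact Submodule.smul_mem _ _ (Submodule.mem_span_singleton_self _)

end SingleMode

end

theorem lemma1 (d : ℕ) (hd : 2 ≤ d) (ρ : SingleMode.ModeSpace →L[ℂ] SingleMode.ModeSpace)
    (hρ : SingleMode.IsDensityOperator ρ)
    (hsupp : LinearMap.range ρ.toLinearMap ≤ SingleMode.fockSpan d) :
    (SingleMode.IsGaussianState ρ ↔ ρ = SingleMode.vacuum) ∧
    (¬ LinearMap.range ρ.toLinearMap ≤ SingleMode.fockSpan (d - 1) →
      ¬ SingleMode.IsGaussianState ρ) ∧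
    (Module.finrank ℂ (LinearMap.range ρ.toLinearMap) = d →
      ¬ SingleMode.IsGaussianState ρ) := by
  refine ⟨⟨fun h => h.eq_vacuum hsupp, fun h => h ▸ SingleMode.isGaussianState_vacuum⟩,
    fun hn h => hn ?_, fun hr h => ?_⟩
  · rw [h.eq_vacuum hsupp]
    refine SingleMode.range_vacuum_le.trans (Submodule.span_mono ?_)
    rintro _ rfl
    -- `0 < d - 1` is where `2 ≤ d` is needed.
    exact ⟨0, by simp only [Set.mem_ofPred_eq]; omega, rfl⟩
  · rw [h.eq_vacuum hsupp] at hr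
    have h1 := Submodule.finrank_mono SingleMode.range_vacuum_le
    have h2 : Module.finrank ℂ (Submodule.span ℂ {SingleMode.fock 0}) ≤ 1 := by
      simpa using finrank_span_le_card (R := ℂ) ({SingleMode.fock 0} : Set SingleMode.ModeSpace)
    omega
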